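/- Let $f:\mathbb{R}^n\to\mathbb{R}$ be convex and $L$-smooth for some $L>0$ (differentiable with $L$-Lipschitz gradient for the Euclidean norm), let $g:\mathbb{R}^n\to\mathbb{R}\cup\{+\infty\}$ be convex, proper and lower semicontinuous, and assume that the set $X^\star=\operatorname{argmin}_{x\in\mathbb{R}^n}\,(f(x)+g(x))$ is nonempty. Let $\mathcal{C}=\{\mathcal{C}_i\}_{i}$ be a (finite or infinite) family of linear subspaces of $\mathbb{R}^n$ that is covering, i.e. $\sum_i\mathcal{C}_i=\mathbb{R}^n$. A selection is a random subspace obtained as the sum of a random subfamily of $\mathcal{C}$; a selection $\mathfrak{S}$ is admissible if $\mathbb{P}[x\in\mathfrak{S}^\perp]<1$ for every $x\in\mathbb{R}^n\setminus\{0\}$. Let $\mathfrak{S}^1,\mathfrak{S}^2,\dots$ be an i.i.d. sequence of admissible selections. Denote by $P_F$ the orthogonal projection matrix onto a subspace $F$, and put $\mathsf{P}=\mathbb{E}[P_{\mathfrak{S}^1}]$ (a positive definite matrix) and $\mathsf{Q}=\mathsf{P}^{-1/2}$. For $\gamma>0$ let $$\mathbf{prox}_{\gamma g}(x)=\operatorname*{argmin}_{y\in\mathbb{R}^n}\Big\{g(y)+\tfrac1{2\gamma}\|y-x\|_2^2\Big\}.$$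 The randomized proximal subspace descent (RPSD) algorithm starts from an arbitrary $z^0\in\mathbb{R}^n$ and $x^1=\mathbf{prox}_{\gamma g}(\mathsf{Q}^{-1}z^0)$, and computes for $k=1,2,\dots$ $$y^k=\mathsf{Q}\big(x^k-\gamma\nabla f(x^k)\big),\qquad z^k=P_{\mathfrak{S}^k}y^k+(I-P_{\mathfrak{S}^k})z^{k-1},\qquad x^{k+1}=\mathbf{prox}_{\gamma g}\big(\mathsf{Q}^{-1}z^k\big).$$ Then, for any $\gamma\in(0,2/L)$, the sequence $(x^k)$ of the iterates of RPSD converges almost surely to a (possibly random) point of $X^\star$: with probability one, there is $x^\infty\in X^\star$ such that $x^k\to x^\infty$. -/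

import Mathlib

open MeasureTheory ProbabilityTheory Filter Topology

namespace RPSD

noncomputable section

/-- `ℝⁿ` with its Euclidean norm. -/
abbrev E (n : ℕ) : Type := EuclideanSpace ℝ (Fin n)

/-! ### Random subspaces -/

/-- The σ-algebra on the set of linear subspaces of `ℝⁿ`: the Borel σ-algebra obtained by
identifying a subspace `F` with the orthogonal projection onto `F`. -/
instance instMeasurableSpaceSubspace (n : ℕ) : MeasurableSpace (Submodule ℝ (E n)) :=
  MeasurableSpace.comap (fun F => F.starProjection) (borel (E n →L[ℝ] E n))

/-- A family of subspaces is covering if its sum is the whole space. -/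
def IsCovering {n : ℕ} {ι : Type*} (C : ι → Submodule ℝ (E n)) : Prop :=
  ⨆ i, C i = ⊤

/-- The random subspace `ω ↦ ∑_{i ∈ S ω} C i` attached to a random set of indices `S`. -/
def selection {n : ℕ} {ι Ω : Type*} (C : ι → Submodule ℝ (E n)) (S : Ω → Set ι) :
    Ω → Submodule ℝ (E n) :=
  fun ω => ⨆ i ∈ S ω, C i

/-- A random subspace is admissible if no nonzero vector is almost surely orthogonal to it. -/
def IsAdmissible {n : ℕ} {Ω : Type*} [MeasurableSpace Ω] (μ : Measure Ω)
    (F : Ω → Submodule ℝ (E n)) : Prop :=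
  ∀ x : E n, x ≠ 0 → μ {ω | x ∈ (F ω)ᗮ} < 1

/-- The matrix of the orthogonal projection onto `F`. -/
def projMatrix {n : ℕ} (F : Submodule ℝ (E n)) : Matrix (Fin n) (Fin n) ℝ :=
  (Matrix.toEuclideanCLM (n := Fin n) (𝕜 := ℝ)).symm F.starProjection

/-- The average projection matrix `𝖯 = 𝔼[P_F]` (entrywise expectation). -/
def avgProj {n : ℕ} {Ω : Type*} [MeasurableSpace Ω] (μ : Measure Ω)
    (F : Ω → Submodule ℝ (E n)) : Matrix (Fin n) (Fin n) ℝ :=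
  Matrix.of fun i j => ∫ ω, projMatrix (F ω) i j ∂μ

open scoped MatrixOrder in
/-- The inverse square root `P^{-1/2}` of a positive definite matrix `P`. -/
def invSqrt {n : ℕ} (P : Matrix (Fin n) (Fin n) ℝ) : Matrix (Fin n) (Fin n) ℝ :=
  (CFC.sqrt P)⁻¹

/-! ### The optimization problem -/

/-- `f` is differentiable with `L`-Lipschitz gradient. -/
def IsSmooth {n : ℕ} (L : ℝ) (f : E n → ℝ) : Prop :=
  Differentiable ℝ f ∧ ∀ x y, ‖gradient f x - gradient f y‖ ≤ L * ‖x - y‖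

/-- Convexity of an extended real valued function: its epigraph is convex. -/
def IsConvex {n : ℕ} (g : E n → EReal) : Prop :=
  Convex ℝ {p : E n × ℝ | g p.1 ≤ (p.2 : EReal)}

/-- `g` never takes the value `-∞` and is not identically `+∞`. -/
def IsProper {n : ℕ} (g : E n → EReal) : Prop :=
  (∀ x, g x ≠ ⊥) ∧ ∃ x, g x ≠ ⊤

/-- The set of minimizers over `ℝⁿ` of an extended real valued function. -/
def argmin {n : ℕ} (h : E n → EReal) : Set (E n) :=
  {x | ∀ y, h x ≤ h y}

/-- The set `X⋆` of minimizers of `f + g`. -/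
def minimizers {n : ℕ} (f : E n → ℝ) (g : E n → EReal) : Set (E n) :=
  argmin fun x => (f x : EReal) + g x

/-- The proximity operator `prox_{γ g}(x)`: the minimizer of `y ↦ g y + ‖y - x‖² / (2 γ)`
(which exists and is unique for `γ > 0` and `g` convex, proper, lower semicontinuous). -/
def prox {n : ℕ} (γ : ℝ) (g : E n → EReal) (x : E n) : E n :=
  Classical.epsilon fun p =>
    p ∈ argmin fun y => g y + ((1 / (2 * γ) * ‖y - x‖ ^ 2 : ℝ) : EReal)

/-! ### The algorithm -/

/-- The action of a matrix on `ℝⁿ`. -/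
def act {n : ℕ} (A : Matrix (Fin n) (Fin n) ℝ) (x : E n) : E n :=
  Matrix.toEuclideanCLM (n := Fin n) (𝕜 := ℝ) A x

/-- The gradient step `y = Q (x - γ ∇f(x))`. -/
def gradStep {n : ℕ} (f : E n → ℝ) (γ : ℝ) (Q : Matrix (Fin n) (Fin n) ℝ) (x : E n) : E n :=
  act Q (x - γ • gradient f x)

/-- The step `x = prox_{γ g}(Q⁻¹ z)`. -/
def proxStep {n : ℕ} (g : E n → EReal) (γ : ℝ) (Q : Matrix (Fin n) (Fin n) ℝ) (z : E n) : E n :=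
  prox γ g (act Q⁻¹ z)

/-- The sequence `z⁰, z¹, …` of the algorithm run with the subspaces `F 0, F 1, …`
(`F k` is the subspace used to compute `zᵏ⁺¹` from `zᵏ`):
`zᵏ⁺¹ = P_{F k} yᵏ⁺¹ + (I - P_{F k}) zᵏ`, where `yᵏ⁺¹ = Q (xᵏ⁺¹ - γ ∇f(xᵏ⁺¹))` and
`xᵏ⁺¹ = prox_{γ g}(Q⁻¹ zᵏ)`. -/
def iterZ {n : ℕ} (f : E n → ℝ) (g : E n → EReal) (γ : ℝ) (Q : Matrix (Fin n) (Fin n) ℝ)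
    (z₀ : E n) (F : ℕ → Submodule ℝ (E n)) : ℕ → E n
  | 0 => z₀
  | k + 1 =>
    let z := iterZ f g γ Q z₀ F k
    let y := gradStep f γ Q (proxStep g γ Q z)
    act (projMatrix (F k)) y + act (1 - projMatrix (F k)) z

/-- The iterates: `iterX … k` is `xᵏ⁺¹ = prox_{γ g}(Q⁻¹ zᵏ)`, for `k = 0, 1, …`. -/
def iterX {n : ℕ} (f : E n → ℝ) (g : E n → EReal) (γ : ℝ) (Q : Matrix (Fin n) (Fin n) ℝ)
    (z₀ : E n) (F : ℕ → Submodule ℝ (E n)) (k : ℕ) : E n :=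
  proxStep g γ Q (iterZ f g γ Q z₀ F k)

end

end RPSD

/-! Put `R = P^{1/2} = Q⁻¹` and `G u = prox u - γ ∇f(prox u)`. One full (unprojected) step is `T z =
Q G(R z)`, conjugate to `G` through `u = R z`. Firm nonexpansiveness of `prox` and cocoercivity of
`∇f` make `G` nonexpansive with a quantitative decrease (`forwardBackward_decrease`), so `T` is
nonexpansive for the norm `⟪x, P x⟫ = ‖R x‖²`, though not for the Euclidean one.

Fix `q = T q`. Expanding the projected step orthogonally and averaging over the fresh subspace,
independent of the past, gives `𝔼[‖zᵏ⁺¹ - q‖² | past] = ‖zᵏ - q‖² - (‖R(zᵏ - q)‖² - ‖R(T zᵏ -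
q)‖²)`. The scaling by `Q` makes this decrease nonnegative. Supermartingale convergence
(`ae_tendsto_of_condExp_eq_sub`) then shows that almost surely `‖zᵏ - q‖` converges and the decrease
tends to `0`. The latter forces `zᵏ - T zᵏ → 0`, so cluster points of `zᵏ` are fixed by `T`, and
Opial's argument yields convergence (`ae_exists_tendsto_fixedPoint`). Finally `prox ∘ R` is
continuous and sends fixed points of `T` to minimizers. -/

namespace RPSD

open scoped RealInnerProductSpace

/-! ### Convex functions with Lipschitz gradient -/

section Smooth

variable {V : Type*} [NormedAddCommGroup V] [InnerProductSpace ℝ V] [CompleteSpace V]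

theorem le_inner_of_hasGradientAt {h : V → ℝ} {v p d : V} {c : ℝ} (hh : HasGradientAt h v p)
    (hc : ∀ t : ℝ, 0 < t → t ≤ 1 → c * t ≤ h (p + t • d) - h p) : c ≤ ⟪v, d⟫ := by
  have hd : HasDerivAt (fun t : ℝ => p + t • d) d 0 := by
    simpa using ((hasDerivAt_id (0 : ℝ)).smul_const d).const_add p
  have hh' : HasFDerivAt h (InnerProductSpace.toDual ℝ V v) (p + (0 : ℝ) • d) := by
    simpa using hh.hasFDerivAt
  have h1 := hh'.comp_hasDerivAt (0 : ℝ) hd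
  have h2 := h1.tendsto_slope_zero_right
  simp only [InnerProductSpace.toDual_apply_apply] at h2
  refine ge_of_tendsto h2 ?_
  filter_upwards [Ioc_mem_nhdsGT (zero_lt_one' ℝ)] with t ht
  have := hc t ht.1 ht.2
  simp only [Function.comp, zero_add, zero_smul, add_zero, smul_eq_mul]
  rw [inv_mul_eq_div, le_div_iff₀ ht.1]
  exact this

theorem inner_gradient_le_sub {f : V → ℝ} (hf : ConvexOn ℝ Set.univ f) {x v : V}
    (hv : HasGradientAt f v x) (y : V) : ⟪v, y - x⟫ ≤ f y - f x := by
  have hneg : HasGradientAt (fun z => -f z) (-v) x := by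
    rw [hasGradientAt_iff_hasFDerivAt] at hv ⊢
    rw [map_neg]
    exact hv.neg
  have := le_inner_of_hasGradientAt (d := y - x) (c := -(f y - f x)) hneg ?_
  · rw [inner_neg_left] at this
    linarith
  · intro t h0 h1
    have := hf.2 (Set.mem_univ x) (Set.mem_univ y) (sub_nonneg.2 h1) h0.le (sub_add_cancel 1 t)
    have e : (1 - t) • x + t • y = x + t • (y - x) := by module
    rw [e] at this
    simp only [smul_eq_mul] at this
    nlinarith

theorem le_quadratic_of_lipschitz_gradient {f : V → ℝ} {L : ℝ}
    (hd : Differentiable ℝ f) (hL : ∀ x y, ‖gradient f x - gradient f y‖ ≤ L * ‖x - y‖) (x d : V) :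
    f (x + d) ≤ f x + ⟪gradient f x, d⟫ + L / 2 * ‖d‖ ^ 2 := by
  -- The Lipschitz bound on the gradient makes `φ' ≤ 0` on `(0, 1)`; comparing `φ 1` with `φ 0`
  -- avoids integrating the gradient.
  set φ : ℝ → ℝ := fun t => f (x + t • d) - t * ⟪gradient f x, d⟫ - L / 2 * ‖d‖ ^ 2 * t ^ 2 with hφ
  have hder : ∀ t, HasDerivAt φ
      (⟪gradient f (x + t • d), d⟫ - ⟪gradient f x, d⟫ - L / 2 * ‖d‖ ^ 2 * (2 * t)) t := by
    intro t
    have h1 : HasDerivAt (fun t : ℝ => x + t • d) d t := by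
      simpa using ((hasDerivAt_id t).smul_const d).const_add x
    have h2 := (hd (x + t • d)).hasGradientAt.hasFDerivAt.comp_hasDerivAt t h1
    simp only [InnerProductSpace.toDual_apply_apply] at h2
    have h3 := (h2.sub ((hasDerivAt_id t).mul_const ⟪gradient f x, d⟫)).sub
      ((hasDerivAt_pow 2 t).const_mul (L / 2 * ‖d‖ ^ 2))
    exact h3.congr_deriv (by simp)
  have hanti : AntitoneOn φ (Set.Icc 0 1) := by
    refine antitoneOn_of_deriv_nonpos (convex_Icc 0 1)
      (fun t _ => (hder t).continuousAt.continuousWithinAt)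
      (fun t _ => (hder t).differentiableAt.differentiableWithinAt) ?_
    intro t ht
    rw [interior_Icc] at ht
    rw [(hder t).deriv, ← inner_sub_left]
    have h1 := real_inner_le_norm (gradient f (x + t • d) - gradient f x) d
    have h2 := hL (x + t • d) x
    rw [add_sub_cancel_left, norm_smul, Real.norm_of_nonneg ht.1.le] at h2
    nlinarith [norm_nonneg d, mul_le_mul_of_nonneg_right h2 (norm_nonneg d)]
  have := hanti (Set.left_mem_Icc.2 zero_le_one) (Set.right_mem_Icc.2 zero_le_one) zero_le_one
  simp only [hφ, one_smul, zero_smul, add_zero] at this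
  linarith

theorem inner_gradient_sub_add_le {f : V → ℝ} {L : ℝ} (hLpos : 0 < L)
    (hf : ConvexOn ℝ Set.univ f) (hd : Differentiable ℝ f)
    (hL : ∀ x y, ‖gradient f x - gradient f y‖ ≤ L * ‖x - y‖) (x y : V) :
    f x + ⟪gradient f x, y - x⟫ + 1 / (2 * L) * ‖gradient f y - gradient f x‖ ^ 2 ≤ f y := by
  set w := gradient f y - gradient f x with hw
  -- The point `y - w / L` minimizes the quadratic upper bound at `y` for the convex function `f -
  -- ⟪∇f x, ·⟫`, which is itself minimal at `x`.
  have h1 := inner_gradient_le_sub hf (hd x).hasGradientAt (y + (-(1 / L)) • w)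
  have h2 := le_quadratic_of_lipschitz_gradient hd hL y ((-(1 / L)) • w)
  have e1 : ⟪gradient f x, y + (-(1 / L)) • w - x⟫
      = ⟪gradient f x, y - x⟫ - 1 / L * ⟪gradient f x, w⟫ := by
    rw [add_sub_right_comm, inner_add_right, inner_smul_right]; ring
  have e2 : ⟪gradient f y, w⟫ - ⟪gradient f x, w⟫ = ‖w‖ ^ 2 := by
    rw [← inner_sub_left, ← hw, real_inner_self_eq_norm_sq]
  rw [inner_smul_right, norm_smul, mul_pow, Real.norm_eq_abs, sq_abs] at h2
  rw [e1] at h1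
  have e3 : L / 2 * ((-(1 / L)) ^ 2 * ‖w‖ ^ 2) = 1 / (2 * L) * ‖w‖ ^ 2 := by
    field_simp
  have e4 : 1 / L * ‖w‖ ^ 2 = 2 * (1 / (2 * L) * ‖w‖ ^ 2) := by field_simp
  rw [e3] at h2
  rw [← e2] at e4 h2 ⊢
  linarith

/-- The **Baillon–Haddad** inequality: the gradient of a convex `L`-smooth function is
`1 / L`-cocoercive. -/
theorem gradient_cocoercive {f : V → ℝ} {L : ℝ} (hLpos : 0 < L)
    (hf : ConvexOn ℝ Set.univ f) (hd : Differentiable ℝ f)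
    (hL : ∀ x y, ‖gradient f x - gradient f y‖ ≤ L * ‖x - y‖) (x y : V) :
    1 / L * ‖gradient f x - gradient f y‖ ^ 2 ≤ ⟪gradient f x - gradient f y, x - y⟫ := by
  have h1 := inner_gradient_sub_add_le hLpos hf hd hL x y
  have h2 := inner_gradient_sub_add_le hLpos hf hd hL y x
  rw [norm_sub_rev] at h1
  have e1 : ⟪gradient f x - gradient f y, x - y⟫
      = -⟪gradient f x, y - x⟫ - ⟪gradient f y, x - y⟫ := by
    rw [inner_sub_left, ← neg_sub y x, inner_neg_right]
  have e4 : 1 / L * ‖gradient f x - gradient f y‖ ^ 2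
    = 2 * (1 / (2 * L) * ‖gradient f x - gradient f y‖ ^ 2) := by field_simp
  rw [e1, e4]
  linarith

theorem norm_sq_gradient_step_sub_le {f : V → ℝ} {L γ : ℝ} (hLpos : 0 < L) (hγ : 0 < γ)
    (hf : ConvexOn ℝ Set.univ f) (hd : Differentiable ℝ f)
    (hL : ∀ x y, ‖gradient f x - gradient f y‖ ≤ L * ‖x - y‖) (x y : V) :
    ‖(x - γ • gradient f x) - (y - γ • gradient f y)‖ ^ 2
      + γ * (2 / L - γ) * ‖gradient f x - gradient f y‖ ^ 2 ≤ ‖x - y‖ ^ 2 := by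
  have h := gradient_cocoercive hLpos hf hd hL x y
  have e : (x - γ • gradient f x) - (y - γ • gradient f y)
      = (x - y) - γ • (gradient f x - gradient f y) := by module
  rw [e, norm_sub_sq_real, inner_smul_right, real_inner_comm, norm_smul, mul_pow,
    Real.norm_eq_abs, sq_abs]
  have h' := mul_le_mul_of_nonneg_left h hγ.le
  have e2 : γ * (2 / L - γ) * ‖gradient f x - gradient f y‖ ^ 2
    = 2 * (γ * (1 / L * ‖gradient f x - gradient f y‖ ^ 2))
      - γ ^ 2 * ‖gradient f x - gradient f y‖ ^ 2 := by ring
  rw [e2]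
  linarith

theorem hasGradientAt_quadratic (γ : ℝ) (u p : V) :
    HasGradientAt (fun y => 1 / (2 * γ) * ‖y - u‖ ^ 2) ((1 / γ) • (p - u)) p := by
  rw [hasGradientAt_iff_hasFDerivAt]
  have h := ((hasFDerivAt_id p).sub_const u).norm_sq.const_mul (1 / (2 * γ))
  refine h.congr_fderiv ?_
  ext z
  simp
  ring

end Smooth

/-! ### Subgradients and the proximity operator -/

section Subgradient

variable {n : ℕ}

/-- `g p` is finite and `v` is a subgradient of `g` at `p`. -/
def IsSubgradient (g : E n → EReal) (p v : E n) : Prop :=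
  ∃ a : ℝ, g p = a ∧ ∀ y, ((a + ⟪v, y - p⟫ : ℝ) : EReal) ≤ g y

theorem IsSubgradient.monotone {g : E n → EReal} {p v q w : E n} (hp : IsSubgradient g p v)
    (hq : IsSubgradient g q w) : 0 ≤ ⟪v - w, p - q⟫ := by
  obtain ⟨a, ha, hp⟩ := hp
  obtain ⟨b, hb, hq⟩ := hq
  have h1 := hp q
  have h2 := hq p
  rw [hb, EReal.coe_le_coe_iff, ← neg_sub p q, inner_neg_right] at h1
  rw [ha, EReal.coe_le_coe_iff] at h2
  rw [inner_sub_left]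
  linarith

/-- Fermat's rule for a smooth plus a convex term: moving from `p` towards `y` by a fraction `t`,
convexity bounds the growth of `g` by `t (g y - g p)`, so minimality bounds the slope of `h` from
below. -/
theorem IsSubgradient.of_argmin {h : E n → ℝ} {g : E n → EReal} {p v : E n}
    (hh : HasGradientAt h v p) (hg_convex : IsConvex g) (hg_proper : IsProper g)
    (hp : p ∈ argmin fun y => (h y : EReal) + g y) : IsSubgradient g p (-v) := by
  have hfin : g p ≠ ⊤ := by
    intro htop
    obtain ⟨x, hx⟩ := hg_proper.2
    have := hp x
    simp only [htop] at this
    lift g x to ℝ using ⟨hx, hg_proper.1 x⟩ with b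
    rw [EReal.coe_add_top, top_le_iff] at this
    exact EReal.coe_ne_top (h x + b) (by exact_mod_cast this)
  obtain ⟨a, ha⟩ : ∃ a : ℝ, g p = a := ⟨_, (EReal.coe_toReal hfin (hg_proper.1 p)).symm⟩
  refine ⟨a, ha, fun y => ?_⟩
  by_cases hy : g y = ⊤
  · rw [hy]; exact le_top
  obtain ⟨b, hb⟩ : ∃ b : ℝ, g y = b := ⟨_, (EReal.coe_toReal hy (hg_proper.1 y)).symm⟩
  rw [hb, EReal.coe_le_coe_iff, inner_neg_left]
  have := le_inner_of_hasGradientAt (d := y - p) (c := a - b) hh ?_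
  · linarith
  intro t h0 h1
  have hc := hg_convex (x := (p, a)) (y := (y, b)) ha.le hb.le
    (a := 1 - t) (b := t) (by linarith) h0.le (by ring)
  have e : (1 - t) • p + t • y = p + t • (y - p) := by module
  simp only [Set.mem_ofPred_eq, Prod.smul_mk, Prod.mk_add_mk, e, smul_eq_mul] at hc
  have hm := (hp (p + t • (y - p))).trans (add_le_add le_rfl hc)
  simp only [ha] at hm
  have hm' : h p + a ≤ h (p + t • (y - p)) + ((1 - t) * a + t * b) := by exact_mod_cast hm
  linarith

theorem IsSubgradient.argmin {h : E n → ℝ} {g : E n → EReal} {p v : E n}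
    (hp : IsSubgradient g p v) (hh : ∀ y, h p - ⟪v, y - p⟫ ≤ h y) :
    p ∈ argmin fun y => (h y : EReal) + g y := by
  obtain ⟨a, ha, hp⟩ := hp
  intro y
  simp only [ha]
  calc (h p : EReal) + a = ((h p - ⟪v, y - p⟫ : ℝ) : EReal) + ((a + ⟪v, y - p⟫ : ℝ) : EReal) := by
        norm_cast; ring
    _ ≤ _ := add_le_add (by exact_mod_cast hh y) (hp y)

/-- One subgradient gives an affine minorant of `g`, so the quadratic term makes the objective
coercive and a minimum over a compact ball is global. -/
theorem exists_mem_argmin_prox {γ : ℝ} (hγ : 0 < γ) {g : E n → EReal}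
    (hg_lsc : LowerSemicontinuous g) {x v : E n} (hx : IsSubgradient g x v) (u : E n) :
    ∃ p, p ∈ argmin fun y => g y + ((1 / (2 * γ) * ‖y - u‖ ^ 2 : ℝ) : EReal) := by
  have hlsc : LowerSemicontinuous
      fun y => g y + ((1 / (2 * γ) * ‖y - u‖ ^ 2 : ℝ) : EReal) := by
    refine hg_lsc.add' (Continuous.lowerSemicontinuous ?_) fun y =>
      EReal.continuousAt_add (Or.inr (EReal.coe_ne_bot _)) (Or.inr (EReal.coe_ne_top _))
    exact continuous_coe_real_ereal.comp (by fun_prop)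
  -- `w` is a subgradient of the whole objective at `x`. Its value at `y` exceeds that at `x` by at
  -- least `⟪w, y - x⟫ + ‖y - x‖² / (2γ)`, which is nonnegative once `‖y - x‖ ≥ 2γ‖w‖`.
  set w := v + (1 / γ) • (x - u) with hw
  set r := 2 * γ * ‖w‖ with hr
  have hr0 : 0 ≤ r := by positivity
  obtain ⟨p, -, hp⟩ := LowerSemicontinuousOn.exists_isMinOn
    ⟨x, Metric.mem_closedBall_self hr0⟩ (isCompact_closedBall x r) (hlsc.lowerSemicontinuousOn _)
  refine ⟨p, fun y => ?_⟩
  by_cases hy : y ∈ Metric.closedBall x r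
  · exact hp hy
  refine (hp (Metric.mem_closedBall_self hr0)).trans ?_
  obtain ⟨a, ha, hx⟩ := hx
  rw [Metric.mem_closedBall, dist_eq_norm, not_le] at hy
  refine le_trans ?_ (add_le_add (hx y) le_rfl)
  simp only [ha]
  norm_cast
  have e : y - u = (y - x) + (x - u) := by abel
  have e2 : ⟪w, y - x⟫ = ⟪v, y - x⟫ + 1 / γ * ⟪y - x, x - u⟫ := by
    rw [hw, inner_add_left, inner_smul_left, real_inner_comm (y - x) (x - u)]; simp
  rw [e, norm_add_sq_real]
  have h1 : -(‖w‖ * ‖y - x‖) ≤ ⟪w, y - x⟫ := by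
    have := abs_real_inner_le_norm w (y - x)
    exact neg_le_of_abs_le this
  have h2 : ‖w‖ * ‖y - x‖ ≤ 1 / (2 * γ) * ‖y - x‖ ^ 2 := by
    have : ‖w‖ = 1 / (2 * γ) * r := by rw [hr]; field_simp
    rw [this, mul_assoc, sq]
    gcongr
  have e3 : 1 / (2 * γ) * (‖y - x‖ ^ 2 + 2 * ⟪y - x, x - u⟫ + ‖x - u‖ ^ 2)
    = 1 / (2 * γ) * ‖y - x‖ ^ 2 + 1 / γ * ⟪y - x, x - u⟫ + 1 / (2 * γ) * ‖x - u‖ ^ 2 := by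
    field_simp
  rw [e3]
  linarith

theorem isSubgradient_prox {γ : ℝ} (hγ : 0 < γ) {g : E n → EReal} (hg_convex : IsConvex g)
    (hg_proper : IsProper g) (hg_lsc : LowerSemicontinuous g) {x v : E n}
    (hx : IsSubgradient g x v) (u : E n) :
    IsSubgradient g (prox γ g u) ((1 / γ) • (u - prox γ g u)) := by
  have hp := Classical.epsilon_spec (exists_mem_argmin_prox hγ hg_lsc hx u)
  simp only [add_comm (g _)] at hp
  have := IsSubgradient.of_argmin (hasGradientAt_quadratic γ u _) hg_convex hg_proper hp
  simp only [add_comm _ (g _)] at this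
  rw [← smul_neg, neg_sub] at this
  exact this

/-- Resolvents of monotone operators are firmly nonexpansive. -/
theorem IsSubgradient.firmly_nonexpansive {γ : ℝ} (hγ : 0 < γ) {g : E n → EReal} {p u q w : E n}
    (hp : IsSubgradient g p ((1 / γ) • (u - p))) (hq : IsSubgradient g q ((1 / γ) • (w - q))) :
    ‖p - q‖ ^ 2 + ‖(u - p) - (w - q)‖ ^ 2 ≤ ‖u - w‖ ^ 2 := by
  have h := hp.monotone hq
  rw [← smul_sub, inner_smul_left] at h
  have h' : 0 ≤ ⟪(u - p) - (w - q), p - q⟫ := by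
    refine nonneg_of_mul_nonneg_right h ?_
    simpa using hγ
  have e : u - w = ((u - p) - (w - q)) + (p - q) := by abel
  rw [e, norm_add_sq_real]
  linarith

theorem IsSubgradient.prox_eq {γ : ℝ} (hγ : 0 < γ) {g : E n → EReal} (hg_convex : IsConvex g)
    (hg_proper : IsProper g) (hg_lsc : LowerSemicontinuous g) {p u : E n}
    (hp : IsSubgradient g p ((1 / γ) • (u - p))) : prox γ g u = p := by
  have h := (isSubgradient_prox hγ hg_convex hg_proper hg_lsc hp u).firmly_nonexpansive hγ hp
  rw [sub_self u, norm_zero] at h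
  have : ‖prox γ g u - p‖ = 0 := by nlinarith [sq_nonneg ‖u - prox γ g u - (u - p)‖, norm_nonneg (prox γ g u - p)]
  exact sub_eq_zero.1 (norm_eq_zero.1 this)

end Subgradient

/-! ### Supermartingale convergence and conditional expectations -/

section Martingale

variable {Ω : Type*} {m m0 : MeasurableSpace Ω} {μ : Measure Ω} [IsFiniteMeasure μ]

theorem ae_exists_tendsto_of_nonneg_supermartingale {ℱ : Filtration ℕ m0} {X : ℕ → Ω → ℝ}
    (hX : Supermartingale X ℱ μ) (h0 : ∀ k ω, 0 ≤ X k ω) :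
    ∀ᵐ ω ∂μ, ∃ c, Tendsto (fun k => X k ω) atTop (𝓝 c) := by
  have hb : ∀ k, eLpNorm ((-X) k) 1 μ ≤ (Real.toNNReal (∫ ω, X 0 ω ∂μ) : NNReal) := by
    intro k
    rw [Pi.neg_apply, eLpNorm_neg, eLpNorm_one_eq_lintegral_enorm,
      ← ofReal_integral_norm_eq_lintegral_enorm (hX.integrable k)]
    refine ENNReal.ofReal_le_ofReal ?_
    have h1 : ∀ ω, ‖X k ω‖ = X k ω := fun ω => Real.norm_of_nonneg (h0 k ω)
    simp_rw [h1]
    simpa using hX.setIntegral_le (Nat.zero_le k) MeasurableSet.univ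
  filter_upwards [hX.neg.exists_ae_tendsto_of_bdd hb] with ω ⟨c, hc⟩
  exact ⟨-c, by simpa using hc.neg⟩

/-- A version of the Robbins–Siegmund theorem. -/
theorem ae_tendsto_of_condExp_eq_sub {ℱ : Filtration ℕ m0} {X D : ℕ → Ω → ℝ}
    (hX : StronglyAdapted ℱ X) (hD : StronglyAdapted ℱ D) (hXi : ∀ k, Integrable (X k) μ)
    (hDi : ∀ k, Integrable (D k) μ) (hX0 : ∀ k ω, 0 ≤ X k ω) (hD0 : ∀ k ω, 0 ≤ D k ω)
    (hce : ∀ k, μ[X (k + 1) | ℱ k] =ᵐ[μ] X k - D k) :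
    ∀ᵐ ω ∂μ, (∃ c, Tendsto (fun k => X k ω) atTop (𝓝 c)) ∧
      Tendsto (fun k => D k ω) atTop (𝓝 0) := by
  have hXs : Supermartingale X ℱ μ := by
    refine supermartingale_nat hX hXi fun k => ?_
    filter_upwards [hce k] with ω hω
    rw [hω]
    simpa using hD0 k ω
  -- Both `X` and `X` plus the accumulated decreases `A` are nonnegative supermartingales. Their
  -- limits exist, so `A` converges and its increments `D k` vanish.
  set A : ℕ → Ω → ℝ := fun k => ∑ j ∈ Finset.range k, D j with hA
  have hAm : ∀ k, StronglyMeasurable[ℱ k] (A (k + 1)) := fun k =>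
    Finset.stronglyMeasurable_sum _ fun j hj =>
      (hD j).mono (ℱ.mono (Nat.lt_succ_iff.1 (Finset.mem_range.1 hj)))
  have hAi : ∀ k, Integrable (A k) μ := fun k => integrable_finsetSum' _ fun j _ => hDi j
  have hYs : Supermartingale (fun k => X k + A k) ℱ μ := by
    refine supermartingale_nat (fun k => ?_) (fun k => (hXi k).add (hAi k)) fun k => ?_
    · refine (hX k).add ?_
      cases k with
      | zero => simpa [hA] using stronglyMeasurable_zero
      | succ k => exact (hAm k).mono (ℱ.mono k.le_succ)
    · filter_upwards [condExp_add (hXi (k + 1)) (hAi (k + 1)) (ℱ k), hce k] with ω h1 h2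
      rw [h1, Pi.add_apply, h2, condExp_of_stronglyMeasurable (ℱ.le k) (hAm k) (hAi (k + 1))]
      simp [hA, Finset.sum_range_succ]
  have hY0 : ∀ k ω, 0 ≤ (X k + A k) ω := by
    intro k ω
    simp only [Pi.add_apply, hA, Finset.sum_apply]
    exact add_nonneg (hX0 k ω) (Finset.sum_nonneg fun j _ => hD0 j ω)
  filter_upwards [ae_exists_tendsto_of_nonneg_supermartingale hXs hX0,
    ae_exists_tendsto_of_nonneg_supermartingale hYs hY0] with ω ⟨c, hc⟩ ⟨d, hd⟩
  refine ⟨⟨c, hc⟩, ?_⟩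
  have hAt : Tendsto (fun k => A k ω) atTop (𝓝 (d - c)) := by
    simpa using hd.sub hc
  have := (hAt.comp (tendsto_add_atTop_nat 1)).sub hAt
  simpa [hA, Finset.sum_range_succ] using this

/-- The pairing of functional and vector is bilinear, so the `m`-measurable factor `Λ` is pulled
out; independence turns the conditional mean of `N` into its mean. -/
theorem condExp_apply_of_indep {W : Type*} [NormedAddCommGroup W] [NormedSpace ℝ W]
    [CompleteSpace W] [SecondCountableTopology W] [MeasurableSpace W] [BorelSpace W]
    (hm : m ≤ m0) {N : Ω → W} (hN : Measurable N)
    (hind : Indep (MeasurableSpace.comap N inferInstance) m μ) (hNi : Integrable N μ)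
    {Λ : Ω → W →L[ℝ] ℝ} (hΛ : StronglyMeasurable[m] Λ) {c : ℝ} (hc : ∀ ω, ‖Λ ω‖ ≤ c) :
    μ[fun ω => Λ ω (N ω) | m] =ᵐ[μ] fun ω => Λ ω (∫ ω, N ω ∂μ) := by
  have h1 := condExp_stronglyMeasurable_bilin_of_bound
    (ContinuousLinearMap.id ℝ (W →L[ℝ] ℝ)) hm hΛ hNi c (ae_of_all _ hc)
  have h2 := condExp_indep_eq hN.comap_le hm (comap_measurable N).stronglyMeasurable hind
  filter_upwards [h1, h2] with ω h1 h2
  rw [h2] at h1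
  exact h1

theorem condExp_inner_apply_of_indep {V : Type*} [NormedAddCommGroup V] [InnerProductSpace ℝ V]
    [FiniteDimensional ℝ V] (hm : m ≤ m0)
    {N : Ω → V →L[ℝ] V} (hN : Measurable N)
    (hind : Indep (MeasurableSpace.comap N inferInstance) m μ) (hNi : Integrable N μ)
    {a b : Ω → V} (ha : StronglyMeasurable[m] a) (hb : StronglyMeasurable[m] b) {c : ℝ}
    (hac : ∀ ω, ‖a ω‖ ≤ c) (hbc : ∀ ω, ‖b ω‖ ≤ c) :
    μ[fun ω => ⟪a ω, N ω (b ω)⟫ | m] =ᵐ[μ] fun ω => ⟪a ω, (∫ ω, N ω ∂μ) (b ω)⟫ := by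
  have : CompleteSpace V := FiniteDimensional.complete ℝ V
  have hcont : Continuous fun p : V × V =>
      (innerSL ℝ p.1).comp (ContinuousLinearMap.apply ℝ V p.2) := by fun_prop
  have hΛ : StronglyMeasurable[m] fun ω =>
      (innerSL ℝ (a ω)).comp (ContinuousLinearMap.apply ℝ V (b ω)) :=
    hcont.comp_stronglyMeasurable (ha.prodMk hb)
  refine condExp_apply_of_indep hm hN hind hNi hΛ (c := c * c) fun ω => ?_
  refine ContinuousLinearMap.opNorm_le_bound _ (mul_self_nonneg c) fun A => ?_
  have hc : 0 ≤ c := (norm_nonneg _).trans (hac ω)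
  calc ‖⟪a ω, A (b ω)⟫‖ ≤ ‖a ω‖ * ‖A (b ω)‖ := norm_inner_le_norm _ _
    _ ≤ c * (‖A‖ * c) := by
      gcongr
      · exact hac ω
      · exact (A.le_opNorm _).trans (by gcongr; exact hbc ω)
    _ = c * c * ‖A‖ := by ring

end Martingale

/-! ### Fixed point iterations along random subspaces -/

section Iteration

variable {V : Type*} [NormedAddCommGroup V] [InnerProductSpace ℝ V] [FiniteDimensional ℝ V]

/-- Pythagoras: the two summands lie in `F` and `Fᗮ`. The result is linear in the projection, so its
expectation involves only the mean projection. -/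
theorem norm_sq_projection_step (F : Submodule ℝ V) (d e : V) :
    ‖F.starProjection d + (e - F.starProjection e)‖ ^ 2
      = ‖e‖ ^ 2 + ⟪d, F.starProjection d⟫ - ⟪e, F.starProjection e⟫ := by
  have h : ∀ x y, ⟪F.starProjection x, F.starProjection y⟫ = ⟪x, F.starProjection y⟫ := by
    intro x y
    rw [Submodule.inner_starProjection_left_eq_right,
      Submodule.starProjection_eq_self_iff.2 (Submodule.starProjection_apply_mem F y)]
  rw [norm_add_sq_real, norm_sub_sq_real, inner_sub_right, h,
    ← real_inner_self_eq_norm_sq (F.starProjection d),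
    ← real_inner_self_eq_norm_sq (F.starProjection e), h, h,
    Submodule.inner_starProjection_left_eq_right]
  ring

variable {Ω : Type*} [MeasurableSpace Ω] {μ : Measure Ω} [IsProbabilityMeasure μ]

/-- Along `zᵏ⁺¹ = N zᵏ' + (I - N) zᵏ`, with `zᵏ' = T zᵏ` and `N` the projection onto a random
subspace, the distance to a fixed point `q` of `T` converges and the expected decrease of its square
tends to `0`, provided that this decrease is nonnegative. -/
theorem ae_tendsto_norm_sub_fixedPoint {F : ℕ → Ω → Submodule ℝ V}
    (hF : ∀ k, Measurable fun ω => (F k ω).starProjection)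
    (hind : iIndepFun (fun k ω => (F k ω).starProjection) μ)
    {P : V →L[ℝ] V} (hP : ∀ k, ∫ ω, (F k ω).starProjection ∂μ = P)
    {T : V → V} (hT : Continuous T) {κ : ℝ} (hκ : 0 ≤ κ) {q : V}
    (hTq : ∀ x, ‖T x - q‖ ≤ κ * ‖x - q‖)
    (hdec : ∀ x, ⟪T x - q, P (T x - q)⟫ ≤ ⟪x - q, P (x - q)⟫)
    {z : ℕ → Ω → V} {z₀ : V} (hz0 : ∀ ω, z 0 ω = z₀)
    (hz : ∀ k ω, z (k + 1) ω = (F k ω).starProjection (T (z k ω))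
      + (z k ω - (F k ω).starProjection (z k ω))) :
    ∀ᵐ ω ∂μ, (∃ c, Tendsto (fun k => ‖z k ω - q‖ ^ 2) atTop (𝓝 c)) ∧
      Tendsto (fun k => ⟪z k ω - q, P (z k ω - q)⟫ - ⟪T (z k ω) - q, P (T (z k ω) - q)⟫)
        atTop (𝓝 0) := by
  have : CompleteSpace V := FiniteDimensional.complete ℝ V
  set N : ℕ → Ω → V →L[ℝ] V := fun k ω => (F k ω).starProjection with hN
  have hNs : ∀ k, StronglyMeasurable (N k) := fun k => (hF k).stronglyMeasurable
  have hN1 : ∀ k ω, ‖N k ω‖ ≤ 1 := fun k ω => Submodule.starProjection_norm_le _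
  have hNi : ∀ k, Integrable (N k) μ := fun k =>
    Integrable.of_bound (hNs k).aestronglyMeasurable 1 (ae_of_all _ (hN1 k))
  set ℱ := Filtration.natural N hNs with hℱ
  have hNℱ : ∀ k, StronglyMeasurable[ℱ k] (N k) := fun k => Filtration.stronglyAdapted_natural hNs k
  have happ : Continuous fun p : (V →L[ℝ] V) × V => p.1 p.2 := by fun_prop
  have hstep : ∀ k (m : MeasurableSpace Ω), StronglyMeasurable[m] (N k) →
      StronglyMeasurable[m] (z k) → StronglyMeasurable[m] (z (k + 1)) := by
    intro k m h1 h2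
    rw [funext (hz k)]
    exact (happ.comp_stronglyMeasurable (h1.prodMk (hT.comp_stronglyMeasurable h2))).add
      (h2.sub (happ.comp_stronglyMeasurable (h1.prodMk h2)))
  have hzm : ∀ k, StronglyMeasurable[ℱ k] (z (k + 1)) := by
    intro k
    induction k with
    | zero =>
      refine hstep 0 _ (hNℱ 0) ?_
      rw [funext hz0]
      exact stronglyMeasurable_const
    | succ k ih => exact hstep _ _ (hNℱ _) (ih.mono (ℱ.mono k.le_succ))
  -- The bound depends on `k` but not on `ω`; it makes every integrability claim immediate.
  have hbound : ∀ k, ∃ c, ∀ ω, ‖z k ω - q‖ ≤ c := by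
    intro k
    induction k with
    | zero => exact ⟨‖z₀ - q‖, fun ω => by rw [hz0]⟩
    | succ k ih =>
      obtain ⟨c, hc⟩ := ih
      refine ⟨κ * c + (c + c), fun ω => ?_⟩
      have e : z (k + 1) ω - q = N k ω (T (z k ω) - q) + ((z k ω - q) - N k ω (z k ω - q)) := by
        rw [hz, map_sub, map_sub]; abel
      have hle : ∀ x, ‖N k ω x‖ ≤ ‖x‖ := fun x => by
        simpa using (N k ω).le_of_opNorm_le (hN1 k ω) x
      rw [e]
      refine (norm_add_le _ _).trans (add_le_add ((hle _).trans ((hTq _).trans ?_))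
        ((norm_sub_le _ _).trans (add_le_add (hc ω) ((hle _).trans (hc ω)))))
      gcongr
      exact hc ω
  have hTbound : ∀ k, ∃ c, ∀ ω, ‖z k ω - q‖ ≤ c ∧ ‖T (z k ω) - q‖ ≤ c := by
    intro k
    obtain ⟨c, hc⟩ := hbound k
    refine ⟨max c (κ * c), fun ω => ⟨(hc ω).trans (le_max_left _ _), (hTq _).trans
      (le_trans ?_ (le_max_right _ _))⟩⟩
    gcongr
    exact hc ω
  have hem : ∀ k, StronglyMeasurable[ℱ k] fun ω => z (k + 1) ω - q := fun k =>
    (hzm k).sub stronglyMeasurable_const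
  have hdm : ∀ k, StronglyMeasurable[ℱ k] fun ω => T (z (k + 1) ω) - q := fun k =>
    (hT.comp_stronglyMeasurable (hzm k)).sub stronglyMeasurable_const
  -- Index shift: `ℱ k` already contains `N k`, so `z (k + 1)` is the iterate adapted to it, and `N
  -- (k + 1)` is the fresh projection.
  set X : ℕ → Ω → ℝ := fun k ω => ‖z (k + 1) ω - q‖ ^ 2 with hX
  set D : ℕ → Ω → ℝ := fun k ω => ⟪z (k + 1) ω - q, P (z (k + 1) ω - q)⟫
    - ⟪T (z (k + 1) ω) - q, P (T (z (k + 1) ω) - q)⟫ with hD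
  have hXm : StronglyAdapted ℱ X := fun k => (hem k).norm.pow 2
  have hDm : StronglyAdapted ℱ D := fun k =>
    ((hem k).inner (P.continuous.comp_stronglyMeasurable (hem k))).sub
      ((hdm k).inner (P.continuous.comp_stronglyMeasurable (hdm k)))
  have hquad : ∀ {a : Ω → V} {A : Ω → V →L[ℝ] V} {c C : ℝ}, StronglyMeasurable a →
      StronglyMeasurable A → (∀ ω, ‖a ω‖ ≤ c) → (∀ ω, ‖A ω‖ ≤ C) →
      Integrable (fun ω => ⟪a ω, A ω (a ω)⟫) μ := by
    intro a A c C ha hA hac hAC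
    refine Integrable.of_bound (ha.inner (happ.comp_stronglyMeasurable
      (hA.prodMk ha))).aestronglyMeasurable (c * (C * c)) (ae_of_all _ fun ω => ?_)
    have hc : 0 ≤ c := (norm_nonneg _).trans (hac ω)
    have hC : 0 ≤ C := (norm_nonneg _).trans (hAC ω)
    refine (norm_inner_le_norm _ _).trans ?_
    gcongr
    · exact hac ω
    · refine ((A ω).le_opNorm _).trans ?_
      gcongr
      · exact hAC ω
      · exact hac ω
  have hXi : ∀ k, Integrable (X k) μ := by
    intro k
    obtain ⟨c, hc⟩ := hbound (k + 1)
    refine Integrable.of_bound ((hXm k).mono (ℱ.le k)).aestronglyMeasurable (c ^ 2)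
      (ae_of_all _ fun ω => ?_)
    simp only [hX, norm_pow, norm_norm]
    gcongr
    exact hc ω
  have hDi : ∀ k, Integrable (D k) μ := by
    intro k
    obtain ⟨c, hc⟩ := hTbound (k + 1)
    exact (hquad ((hem k).mono (ℱ.le k)) (stronglyMeasurable_const (b := P)) (fun ω => (hc ω).1)
      fun _ => le_rfl).sub (hquad ((hdm k).mono (ℱ.le k)) (stronglyMeasurable_const (b := P))
        (fun ω => (hc ω).2) fun _ => le_rfl)
  have hce : ∀ k, μ[X (k + 1) | ℱ k] =ᵐ[μ] X k - D k := by
    intro k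
    obtain ⟨c, hc⟩ := hTbound (k + 1)
    have hindk := hind.indep_comap_natural_of_lt hNs k.lt_succ_self
    have h1 := condExp_inner_apply_of_indep (ℱ.le k) (hF (k + 1)) hindk (hNi (k + 1)) (hem k) (hem k)
      (fun ω => (hc ω).1) (fun ω => (hc ω).1)
    have h2 := condExp_inner_apply_of_indep (ℱ.le k) (hF (k + 1)) hindk (hNi (k + 1)) (hdm k) (hdm k)
      (fun ω => (hc ω).2) (fun ω => (hc ω).2)
    have i1 := hquad ((hem k).mono (ℱ.le k)) (hNs (k + 1)) (fun ω => (hc ω).1) (hN1 (k + 1))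
    have i2 := hquad ((hdm k).mono (ℱ.le k)) (hNs (k + 1)) (fun ω => (hc ω).2) (hN1 (k + 1))
    have e : X (k + 1) = (X k + fun ω => ⟪T (z (k + 1) ω) - q, N (k + 1) ω (T (z (k + 1) ω) - q)⟫)
        - fun ω => ⟪z (k + 1) ω - q, N (k + 1) ω (z (k + 1) ω - q)⟫ := by
      ext ω
      simp only [hX, Pi.add_apply, Pi.sub_apply]
      rw [← norm_sq_projection_step, hz (k + 1), map_sub, map_sub]
      congr 2
      abel
    rw [e]
    filter_upwards [condExp_sub ((hXi k).add i2) i1 (ℱ k), condExp_add (hXi k) i2 (ℱ k), h1, h2]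
      with ω a1 a2 a3 a4
    rw [a1, Pi.sub_apply, a2, Pi.add_apply, condExp_of_stronglyMeasurable (ℱ.le k) (hXm k) (hXi k)]
    simp only [hN, hP] at a3 a4 ⊢
    rw [a3, a4]
    simp only [hD, Pi.sub_apply]
    ring
  filter_upwards [ae_tendsto_of_condExp_eq_sub hXm hDm hXi hDi (fun k ω => sq_nonneg _)
    (fun k ω => sub_nonneg.2 (hdec _)) hce] with ω ⟨⟨c, hc⟩, h⟩
  exact ⟨⟨c, (tendsto_add_atTop_iff_nat 1).1 hc⟩,
    (tendsto_add_atTop_iff_nat (f := fun k => ⟪z k ω - q, P (z k ω - q)⟫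
      - ⟪T (z k ω) - q, P (T (z k ω) - q)⟫) 1).1 h⟩

/-- **Opial's argument**: a sequence whose distances to all points of a dense subset `A` of `s`
converge, and whose cluster points belong to `s`, converges to a point of `s`. -/
theorem exists_tendsto_of_tendsto_norm_sub {s A : Set V} (hA : A.Nonempty)
    (hsA : s ⊆ closure A) {z : ℕ → V}
    (hz : ∀ q ∈ A, ∃ c, Tendsto (fun k => ‖z k - q‖ ^ 2) atTop (𝓝 c))
    (hcl : ∀ φ : ℕ → ℕ, StrictMono φ → ∀ x, Tendsto (z ∘ φ) atTop (𝓝 x) → x ∈ s) :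
    ∃ x ∈ s, Tendsto z atTop (𝓝 x) := by
  have hz' : ∀ q ∈ A, ∃ c, Tendsto (fun k => ‖z k - q‖) atTop (𝓝 c) := by
    intro q hq
    obtain ⟨c, hc⟩ := hz q hq
    refine ⟨√c, ?_⟩
    simpa [Real.sqrt_sq] using hc.sqrt
  obtain ⟨q, hq⟩ := hA
  obtain ⟨c, hc⟩ := hz' q hq
  obtain ⟨B, hB⟩ := hc.bddAbove_range
  have hball : ∀ k, z k ∈ Metric.closedBall q B := fun k => by
    rw [Metric.mem_closedBall, dist_eq_norm]
    exact hB ⟨k, rfl⟩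
  have : ProperSpace V := FiniteDimensional.proper ℝ V
  obtain ⟨x, -, φ, hφ, hx⟩ := (isCompact_closedBall q B).tendsto_subseq hball
  have hxs := hcl φ hφ x hx
  refine ⟨x, hxs, Metric.tendsto_nhds.2 fun ε hε => ?_⟩
  obtain ⟨p, hp, hxp⟩ := Metric.mem_closure_iff.1 (hsA hxs) (ε / 2) (half_pos hε)
  obtain ⟨c, hc⟩ := hz' p hp
  -- The subsequence identifies the limit of the whole sequence of distances to `p`.
  have hc' : c = ‖x - p‖ :=
    tendsto_nhds_unique (hc.comp hφ.tendsto_atTop) (hx.sub_const p).norm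
  rw [dist_eq_norm] at hxp
  rw [hc'] at hc
  filter_upwards [hc.eventually_lt_const hxp] with k hk
  rw [dist_eq_norm]
  calc ‖z k - x‖ = ‖(z k - p) - (x - p)‖ := by congr 1; abel
    _ ≤ ‖z k - p‖ + ‖x - p‖ := norm_sub_le _ _
    _ < ε := by linarith

/-- Almost sure convergence of random subspace fixed point iterations. -/
theorem ae_exists_tendsto_fixedPoint {F : ℕ → Ω → Submodule ℝ V}
    (hF : ∀ k, Measurable fun ω => (F k ω).starProjection)
    (hind : iIndepFun (fun k ω => (F k ω).starProjection) μ)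
    {P : V →L[ℝ] V} (hP : ∀ k, ∫ ω, (F k ω).starProjection ∂μ = P)
    {T : V → V} {κ : ℝ} (hκ : 0 ≤ κ) (hT : ∀ x y, ‖T x - T y‖ ≤ κ * ‖x - y‖)
    (hne : (Function.fixedPoints T).Nonempty)
    (hdec : ∀ q ∈ Function.fixedPoints T, ∀ x,
      ⟪T x - q, P (T x - q)⟫ ≤ ⟪x - q, P (x - q)⟫)
    (hreg : ∀ q ∈ Function.fixedPoints T, ∀ x : ℕ → V,
      Tendsto (fun k => ⟪x k - q, P (x k - q)⟫ - ⟪T (x k) - q, P (T (x k) - q)⟫) atTop (𝓝 0) →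
      Tendsto (fun k => x k - T (x k)) atTop (𝓝 0))
    {z : ℕ → Ω → V} {z₀ : V} (hz0 : ∀ ω, z 0 ω = z₀)
    (hz : ∀ k ω, z (k + 1) ω = (F k ω).starProjection (T (z k ω))
      + (z k ω - (F k ω).starProjection (z k ω))) :
    ∀ᵐ ω ∂μ, ∃ x ∈ Function.fixedPoints T, Tendsto (fun k => z k ω) atTop (𝓝 x) := by
  have hTc : Continuous T :=
    (LipschitzWith.of_dist_le_mul (K := ⟨κ, hκ⟩) fun x y => by
      rw [dist_eq_norm, dist_eq_norm]; exact hT x y).continuous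
  -- The exceptional null set depends on `q`; restricting to a countable dense set of fixed points
  -- gives a single null set.
  obtain ⟨A, hAs, hAc, hAd⟩ :=
    (TopologicalSpace.IsSeparable.of_separableSpace (Function.fixedPoints T)).exists_countable_dense_subset
  have hAne : A.Nonempty := by
    rw [← closure_nonempty_iff]
    exact hne.mono hAd
  have hall : ∀ᵐ ω ∂μ, ∀ q ∈ A, (∃ c, Tendsto (fun k => ‖z k ω - q‖ ^ 2) atTop (𝓝 c)) ∧
      Tendsto (fun k => ⟪z k ω - q, P (z k ω - q)⟫ - ⟪T (z k ω) - q, P (T (z k ω) - q)⟫)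
        atTop (𝓝 0) := by
    rw [ae_ball_iff hAc]
    intro q hq
    refine ae_tendsto_norm_sub_fixedPoint hF hind hP hTc hκ (fun x => ?_) (hdec q (hAs hq)) hz0 hz
    have := hT x q
    rwa [(hAs hq : T q = q)] at this
  filter_upwards [hall] with ω hω
  refine exists_tendsto_of_tendsto_norm_sub hAne hAd (fun q hq => (hω q hq).1) fun φ hφ x hx => ?_
  obtain ⟨q, hq⟩ := hAne
  have h1 := (hreg q (hAs hq) _ (hω q hq).2).comp hφ.tendsto_atTop
  have h2 := hx.sub ((hTc.tendsto x).comp hx)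
  exact (sub_eq_zero.1 (tendsto_nhds_unique h2 h1)).symm

end Iteration

/-! ### Projection matrices, their mean and its square root -/

section Matrix

variable {n : ℕ}

theorem act_projMatrix (F : Submodule ℝ (E n)) (x : E n) :
    act (projMatrix F) x = F.starProjection x := by
  rw [act, projMatrix, StarAlgEquiv.apply_symm_apply]

theorem act_one_sub_projMatrix (F : Submodule ℝ (E n)) (x : E n) :
    act (1 - projMatrix F) x = x - F.starProjection x := by
  rw [← act_projMatrix, act, map_sub, map_one]
  rfl

theorem act_mul (A B : Matrix (Fin n) (Fin n) ℝ) (x : E n) : act (A * B) x = act A (act B x) := by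
  rw [act, map_mul]
  rfl

theorem act_one (x : E n) : act (1 : Matrix (Fin n) (Fin n) ℝ) x = x := by
  rw [act, map_one]
  rfl

theorem inner_act_left {A : Matrix (Fin n) (Fin n) ℝ} (hA : A.IsHermitian) (x y : E n) :
    ⟪act A x, y⟫ = ⟪x, act A y⟫ := by
  have h : star (Matrix.toEuclideanCLM (n := Fin n) (𝕜 := ℝ) A)
      = Matrix.toEuclideanCLM (n := Fin n) (𝕜 := ℝ) A := by
    rw [← map_star]
    exact congrArg _ hA
  rw [act, act, ← ContinuousLinearMap.adjoint_inner_left, ← ContinuousLinearMap.star_eq_adjoint, h]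

theorem projMatrix_isHermitian (F : Submodule ℝ (E n)) : (projMatrix F).IsHermitian := by
  refine EquivLike.injective (Matrix.toEuclideanCLM (n := Fin n) (𝕜 := ℝ)) ?_
  rw [← Matrix.star_eq_conjTranspose, map_star, projMatrix, StarAlgEquiv.apply_symm_apply]
  exact isSelfAdjoint_starProjection F

theorem measurable_starProjection :
    Measurable fun F : Submodule ℝ (E n) => F.starProjection :=
  comap_measurable _

variable {Ω : Type*} [MeasurableSpace Ω] {μ : Measure Ω} [IsProbabilityMeasure μ]
  {F : Ω → Submodule ℝ (E n)}

theorem integrable_starProjection (hF : Measurable F) :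
    Integrable (fun ω => (F ω).starProjection) μ :=
  Integrable.of_bound (measurable_starProjection.comp hF).stronglyMeasurable.aestronglyMeasurable 1
    (ae_of_all _ fun _ => Submodule.starProjection_norm_le _)

theorem toEuclideanCLM_avgProj (hF : Measurable F) :
    Matrix.toEuclideanCLM (n := Fin n) (𝕜 := ℝ) (avgProj μ F)
      = ∫ ω, (F ω).starProjection ∂μ := by
  rw [← StarAlgEquiv.eq_symm_apply]
  ext i j
  let ℓ : (E n →L[ℝ] E n) →ₗ[ℝ] ℝ :=
    (Matrix.entryLinearMap ℝ ℝ i j).comp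
      (Matrix.toEuclideanCLM (n := Fin n) (𝕜 := ℝ)).symm.toAlgEquiv.toLinearMap
  exact (LinearMap.toContinuousLinearMap ℓ).integral_comp_comm (integrable_starProjection hF)

theorem inner_act_avgProj (hF : Measurable F) (x : E n) :
    ⟪x, act (avgProj μ F) x⟫ = ∫ ω, ‖(F ω).starProjection x‖ ^ 2 ∂μ := by
  rw [act, toEuclideanCLM_avgProj hF,
    ContinuousLinearMap.integral_apply (integrable_starProjection hF), ← integral_inner]
  · refine integral_congr_ae (ae_of_all _ fun ω => ?_)
    simp only
    rw [← real_inner_self_eq_norm_sq, Submodule.inner_starProjection_left_eq_right,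
      Submodule.starProjection_eq_self_iff.2 (Submodule.starProjection_apply_mem _ x)]
  · exact (integrable_starProjection hF).apply_continuousLinearMap x

/-- Since `⟪x, P x⟫ = 𝔼‖P_F x‖²`, a zero value would put `x` in `Fᗮ` almost surely, against
admissibility. -/
theorem avgProj_posDef (hF : Measurable F) (hadm : IsAdmissible μ F) : (avgProj μ F).PosDef := by
  refine Matrix.PosDef.of_dotProduct_mulVec_pos ?_ fun x hx => ?_
  · ext i j
    simp only [avgProj, Matrix.conjTranspose_apply, Matrix.of_apply, star_trivial]
    refine integral_congr_ae (ae_of_all _ fun ω => ?_)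
    simpa using (projMatrix_isHermitian (F ω)).apply i j
  rw [star_trivial]
  have h := inner_act_avgProj (μ := μ) hF (WithLp.toLp 2 x)
  rw [act, Matrix.inner_toEuclideanCLM] at h
  simp only at h
  rw [h]
  have hx' : WithLp.toLp 2 x ≠ 0 := by simpa using hx
  refine lt_of_le_of_ne (integral_nonneg fun ω => sq_nonneg _) fun h0 => ?_
  have hint : Integrable (fun ω => ‖(F ω).starProjection (WithLp.toLp 2 x)‖ ^ 2) μ := by
    refine Integrable.of_bound (((integrable_starProjection hF).apply_continuousLinearMap
      (WithLp.toLp 2 x)).aestronglyMeasurable.norm.pow 2) (‖(WithLp.toLp 2 x : E n)‖ ^ 2)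
      (ae_of_all _ fun ω => ?_)
    rw [norm_pow, norm_norm]
    gcongr
    exact Submodule.norm_starProjection_apply_le _ _
  have hae := (integral_eq_zero_iff_of_nonneg (fun ω => sq_nonneg _) hint).1 h0.symm
  have hone : μ {ω | WithLp.toLp 2 x ∈ (F ω)ᗮ} = 1 := by
    rw [← prob_compl_eq_zero_iff₀]
    · rw [← compl_mem_ae_iff, compl_compl]
      filter_upwards [hae] with ω hω
      refine (Submodule.starProjection_apply_eq_zero_iff (K := F ω)).1 ?_
      simpa using hω
    · refine (measurableSet_eq_fun (f := fun ω => (F ω).starProjection (WithLp.toLp 2 x))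
        (g := fun _ => 0) ?_ measurable_const).nullMeasurableSet.congr (ae_of_all _ fun ω => ?_)
      · exact (measurable_starProjection.comp hF).apply_continuousLinearMap _
      · exact propext (Submodule.starProjection_apply_eq_zero_iff (K := F ω))
  exact (hadm _ hx').ne hone

open scoped MatrixOrder in
theorem exists_sqrt_of_posDef {P : Matrix (Fin n) (Fin n) ℝ} (hP : P.PosDef) :
    ∃ R : Matrix (Fin n) (Fin n) ℝ, R.IsHermitian ∧ R * R = P ∧ (invSqrt P)⁻¹ = R ∧
      R * invSqrt P = 1 ∧ invSqrt P * R = 1 := by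
  have hnn : 0 ≤ P := hP.posSemidef.nonneg
  have hmul : CFC.sqrt P * CFC.sqrt P = P := CFC.sqrt_mul_sqrt_self P hnn
  have hdet : IsUnit (CFC.sqrt P).det := by
    have h := (Matrix.isUnit_iff_isUnit_det _).1 hP.isUnit
    rw [← hmul, Matrix.det_mul] at h
    exact isUnit_of_mul_isUnit_left h
  exact ⟨CFC.sqrt P, (Matrix.nonneg_iff_posSemidef.1 (CFC.sqrt_nonneg P)).isHermitian, hmul,
    Matrix.nonsing_inv_nonsing_inv _ hdet, Matrix.mul_nonsing_inv _ hdet,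
    Matrix.nonsing_inv_mul _ hdet⟩

end Matrix

/-! ### The forward-backward operator -/

section ForwardBackward

variable {n : ℕ} {f : E n → ℝ} {g : E n → EReal} {L γ : ℝ}

theorem forwardBackward_decrease (hL : 0 < L) (hf_convex : ConvexOn ℝ Set.univ f)
    (hf_smooth : IsSmooth L f) (hγ : 0 < γ)
    (hprox : ∀ u, IsSubgradient g (prox γ g u) ((1 / γ) • (u - prox γ g u))) (u w : E n) :
    ‖(prox γ g u - γ • gradient f (prox γ g u)) - (prox γ g w - γ • gradient f (prox γ g w))‖ ^ 2
      + ‖(u - prox γ g u) - (w - prox γ g w)‖ ^ 2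
      + γ * (2 / L - γ) * ‖gradient f (prox γ g u) - gradient f (prox γ g w)‖ ^ 2
      ≤ ‖u - w‖ ^ 2 := by
  have h1 := (hprox u).firmly_nonexpansive hγ (hprox w)
  have h2 := norm_sq_gradient_step_sub_le hL hγ hf_convex hf_smooth.1 hf_smooth.2
    (prox γ g u) (prox γ g w)
  linarith

theorem continuous_prox (hγ : 0 < γ)
    (hprox : ∀ u, IsSubgradient g (prox γ g u) ((1 / γ) • (u - prox γ g u))) :
    Continuous (prox γ g) := by
  refine (LipschitzWith.of_dist_le_mul (K := 1) fun u w => ?_).continuous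
  rw [dist_eq_norm, dist_eq_norm, NNReal.coe_one, one_mul]
  have h1 := (hprox u).firmly_nonexpansive hγ (hprox w)
  exact (sq_le_sq₀ (norm_nonneg _) (norm_nonneg _)).1
    (by nlinarith [sq_nonneg ‖(u - prox γ g u) - (w - prox γ g w)‖])

/-- At a fixed point `u` the subgradient `(u - prox u) / γ` of `g` equals `-∇f(prox u)`, which is
the optimality condition at `prox u`. -/
theorem prox_mem_minimizers (hγ : 0 < γ) (hf_convex : ConvexOn ℝ Set.univ f)
    (hf_diff : Differentiable ℝ f)
    (hprox : ∀ u, IsSubgradient g (prox γ g u) ((1 / γ) • (u - prox γ g u))) {u : E n}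
    (hu : prox γ g u - γ • gradient f (prox γ g u) = u) : prox γ g u ∈ minimizers f g := by
  have h := hprox u
  have e : (1 / γ) • (u - prox γ g u) = -gradient f (prox γ g u) := by
    nth_rw 1 [← hu]
    rw [sub_sub_cancel_left, smul_neg, smul_smul, one_div_mul_cancel hγ.ne', one_smul]
  rw [e] at h
  refine h.argmin fun y => ?_
  have := inner_gradient_le_sub hf_convex (hf_diff (prox γ g u)).hasGradientAt y
  rw [inner_neg_left]
  linarith

end ForwardBackward

end RPSD

/-! ### Almost sure convergence of RPSD -/

open RPSD RealInnerProductSpace in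
theorem mainTheorem5 {n : ℕ} {ι Ω : Type*} [MeasurableSpace Ω]
    (μ : Measure Ω) [IsProbabilityMeasure μ]
    (f : RPSD.E n → ℝ) (g : RPSD.E n → EReal) (L : ℝ) (hL : 0 < L)
    (hf_convex : ConvexOn ℝ Set.univ f) (hf_smooth : RPSD.IsSmooth L f)
    (hg_convex : RPSD.IsConvex g) (hg_proper : RPSD.IsProper g)
    (hg_lsc : LowerSemicontinuous g)
    (hX : (RPSD.minimizers f g).Nonempty)
    (C : ι → Submodule ℝ (RPSD.E n)) (hC : RPSD.IsCovering C)
    (S : ℕ → Ω → Set ι)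
    (hS_meas : ∀ k, Measurable (RPSD.selection C (S k)))
    (hS_indep : iIndepFun (fun k => RPSD.selection C (S k)) μ)
    (hS_ident : ∀ k, IdentDistrib (RPSD.selection C (S k)) (RPSD.selection C (S 0)) μ μ)
    (hS_adm : ∀ k, RPSD.IsAdmissible μ (RPSD.selection C (S k)))
    (γ : ℝ) (hγ_pos : 0 < γ) (hγ_lt : γ < 2 / L)
    (z₀ : RPSD.E n) :
    ∀ᵐ ω ∂μ, ∃ x ∈ RPSD.minimizers f g,
      Tendsto
        (fun k => RPSD.iterX f g γ (RPSD.invSqrt (RPSD.avgProj μ (RPSD.selection C (S 0)))) z₀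
          (fun j => RPSD.selection C (S j) ω) k)
        atTop (𝓝 x) := by
  obtain ⟨xs, hxs⟩ := hX
  -- Optimality of `xs` supplies the one subgradient of `g` needed for `prox` to be well defined,
  -- with no separation theorem.
  have hsub : IsSubgradient g xs (-gradient f xs) :=
    IsSubgradient.of_argmin (hf_smooth.1 xs).hasGradientAt hg_convex hg_proper hxs
  have hprox := isSubgradient_prox hγ_pos hg_convex hg_proper hg_lsc hsub
  set P := avgProj μ (selection C (S 0)) with hP
  have hPd : P.PosDef := avgProj_posDef (hS_meas 0) (hS_adm 0)
  obtain ⟨R, hRh, hRR, hQinv, hRQ, hQR⟩ := exists_sqrt_of_posDef hPd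
  set Q := invSqrt P with hQ
  set G : E n → E n := fun u => prox γ g u - γ • gradient f (prox γ g u) with hG
  have hdecG : ∀ u w, ‖G u - G w‖ ^ 2 + ‖(u - prox γ g u) - (w - prox γ g w)‖ ^ 2
      + γ * (2 / L - γ) * ‖gradient f (prox γ g u) - gradient f (prox γ g w)‖ ^ 2
      ≤ ‖u - w‖ ^ 2 := forwardBackward_decrease hL hf_convex hf_smooth hγ_pos hprox
  have hcoef : 0 < γ * (2 / L - γ) := mul_pos hγ_pos (sub_pos.2 hγ_lt)
  have hGle : ∀ u w, ‖G u - G w‖ ^ 2 ≤ ‖u - w‖ ^ 2 := fun u w => by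
    have := hdecG u w
    have h2 := mul_nonneg hcoef.le
      (sq_nonneg ‖gradient f (prox γ g u) - gradient f (prox γ g w)‖)
    nlinarith [sq_nonneg ‖(u - prox γ g u) - (w - prox γ g w)‖]
  have hRQ' : ∀ x : E n, act R (act Q x) = x := fun x => by rw [← act_mul, hRQ, act_one]
  have hQR' : ∀ x : E n, act Q (act R x) = x := fun x => by rw [← act_mul, hQR, act_one]
  have hsubR : ∀ x y : E n, act R (x - y) = act R x - act R y := fun x y => map_sub _ x y
  have hsubQ : ∀ x y : E n, act Q (x - y) = act Q x - act Q y := fun x y => map_sub _ x y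
  set T : E n → E n := fun z => gradStep f γ Q (proxStep g γ Q z) with hT
  have hTG : ∀ z, T z = act Q (G (act R z)) := fun z => by
    simp only [hT, gradStep, proxStep, hQinv, hG]
  have hRT : ∀ z, act R (T z) = G (act R z) := fun z => by rw [hTG, hRQ']
  have hPR : ∀ x : E n, ⟪x, Matrix.toEuclideanCLM (n := Fin n) (𝕜 := ℝ) P x⟫ = ‖act R x‖ ^ 2 := by
    intro x
    rw [← real_inner_self_eq_norm_sq, inner_act_left hRh, ← act_mul, hRR]
    rfl
  have hfix : ∀ z ∈ Function.fixedPoints T, G (act R z) = act R z := fun z hz => by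
    rw [← hRT, (hz : T z = z)]
  have hmeas : ∀ k, Measurable fun ω => (selection C (S k) ω).starProjection := fun k =>
    measurable_starProjection.comp (hS_meas k)
  -- In the Euclidean norm `T` is only Lipschitz, with the constant lost in conjugating by `R`; this
  -- serves continuity and boundedness, not the decrease.
  have hT_lip : ∀ x y, ‖T x - T y‖ ≤ ‖Matrix.toEuclideanCLM (n := Fin n) (𝕜 := ℝ) Q‖
      * ‖Matrix.toEuclideanCLM (n := Fin n) (𝕜 := ℝ) R‖ * ‖x - y‖ := by
    intro x y
    rw [hTG, hTG, ← hsubQ, mul_assoc]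
    refine (ContinuousLinearMap.le_opNorm _ _).trans ?_
    gcongr
    refine (le_trans ?_ (ContinuousLinearMap.le_opNorm _ _))
    change _ ≤ ‖act R (x - y)‖
    rw [hsubR]
    exact (sq_le_sq₀ (norm_nonneg _) (norm_nonneg _)).1 (hGle _ _)
  have key := ae_exists_tendsto_fixedPoint (μ := μ) (F := fun k => selection C (S k)) hmeas
    (hS_indep.comp (fun _ U => U.starProjection) fun _ => measurable_starProjection)
    (P := Matrix.toEuclideanCLM (n := Fin n) (𝕜 := ℝ) P)
    (fun k => by
      rw [hP, toEuclideanCLM_avgProj (hS_meas 0)]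
      exact ((hS_ident k).comp measurable_starProjection).integral_eq)
    (T := T) (by positivity) hT_lip ?_ ?_ ?_
    (z := fun k ω => iterZ f g γ Q z₀ (fun j => selection C (S j) ω) k) (z₀ := z₀)
    (fun ω => rfl)
    (fun k ω => by
      rw [iterZ, act_projMatrix, act_one_sub_projMatrix])
  · filter_upwards [key] with ω ⟨z, hz, hlim⟩
    refine ⟨prox γ g (act R z),
      prox_mem_minimizers hγ_pos hf_convex hf_smooth.1 hprox (hfix z hz), ?_⟩
    have hc : Continuous fun z => prox γ g (act R z) :=
      (continuous_prox hγ_pos hprox).comp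
        (Matrix.toEuclideanCLM (n := Fin n) (𝕜 := ℝ) R).continuous
    have := (hc.tendsto z).comp hlim
    simpa only [iterX, proxStep, hQinv, Function.comp_def] using this
  -- In the variable `u = R z`, this witness is the gradient step from `xs`, which `prox` maps back
  -- to `xs`.
  · refine ⟨act Q (xs - γ • gradient f xs), ?_⟩
    have hp : prox γ g (xs - γ • gradient f xs) = xs := by
      refine IsSubgradient.prox_eq hγ_pos hg_convex hg_proper hg_lsc ?_
      rw [sub_sub_cancel_left, smul_neg, smul_smul, one_div_mul_cancel hγ_pos.ne', one_smul]
      exact hsub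
    change T _ = _
    rw [hTG, hRQ']
    simp only [hG, hp]
  · intro q hq x
    have := hGle (act R x) (act R q)
    rw [hfix q hq] at this
    rwa [hPR, hPR, hsubR, hsubR, hRT]
  -- The vanishing decrease dominates the squared variations of `u - prox u` and of `∇f(prox u)`
  -- relative to `w`, the latter because `γ < 2 / L`. The first plus `γ` times the second is `u - G
  -- u`, as `w = G w`; applying `Q` gives `x - T x`.
  · intro q hq x hx
    simp only [hPR, hsubR, hRT] at hx
    set u : ℕ → E n := fun k => act R (x k) with hu
    set w := act R q with hw
    have hGw : G w = w := hfix q hq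
    have hle : ∀ k, ‖(u k - prox γ g (u k)) - (w - prox γ g w)‖ ^ 2
        + γ * (2 / L - γ) * ‖gradient f (prox γ g (u k)) - gradient f (prox γ g w)‖ ^ 2
        ≤ ‖u k - w‖ ^ 2 - ‖G (u k) - w‖ ^ 2 := fun k => by
      have := hdecG (u k) w
      rw [hGw] at this
      linarith
    have hsq : ∀ {v : ℕ → E n}, Tendsto (fun k => ‖v k‖ ^ 2) atTop (𝓝 0) →
        Tendsto v atTop (𝓝 0) := by
      intro v hv
      rw [tendsto_zero_iff_norm_tendsto_zero]
      simpa [Real.sqrt_sq] using hv.sqrt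
    have h1 : Tendsto (fun k => (u k - prox γ g (u k)) - (w - prox γ g w)) atTop (𝓝 0) := by
      refine hsq (squeeze_zero (fun k => sq_nonneg _) (fun k => ?_) hx)
      have := mul_nonneg hcoef.le
        (sq_nonneg ‖gradient f (prox γ g (u k)) - gradient f (prox γ g w)‖)
      linarith [hle k]
    have h2 : Tendsto (fun k => gradient f (prox γ g (u k)) - gradient f (prox γ g w))
        atTop (𝓝 0) := by
      refine hsq (squeeze_zero (fun k => sq_nonneg _) (fun k => ?_)
        (by simpa only [mul_zero] using hx.const_mul (γ * (2 / L - γ))⁻¹))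
      rw [le_inv_mul_iff₀ hcoef]
      linarith [hle k, sq_nonneg ‖(u k - prox γ g (u k)) - (w - prox γ g w)‖]
    have h3 := h1.add (h2.const_smul γ)
    rw [smul_zero, add_zero] at h3
    have h4 := ((Matrix.toEuclideanCLM (n := Fin n) (𝕜 := ℝ) Q).continuous.tendsto 0).comp h3
    rw [map_zero] at h4
    refine h4.congr fun k => ?_
    have e : (u k - prox γ g (u k)) - (w - prox γ g w)
        + γ • (gradient f (prox γ g (u k)) - gradient f (prox γ g w)) = u k - G (u k) := by
      have e1 : (u k - prox γ g (u k)) - (w - prox γ g w)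
          + γ • (gradient f (prox γ g (u k)) - gradient f (prox γ g w))
          = (u k - G (u k)) - (w - G w) := by
        simp only [hG]
        module
      rw [e1, hGw, sub_self, sub_zero]
    rw [Function.comp_apply, e]
    change act Q _ = _
    rw [hsubQ, hTG, hu, hQR']
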